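/- Let $\mathbb{k}$ be an algebraically closed field, let $H$ be a finite-dimensional associative unital $\mathbb{k}$-algebra and let $A \subset H$ be a (unital) subalgebra such that $\mathrm{rad}(A) = \mathrm{rad}(H) =: I$ (Jacobson radicals, as subsets of $H$). Put $\bar A = A/I$ and $\bar H = H/I$. For $C \in \{A, H, \bar A, \bar H\}$ let $C\text{-}\mathsf{pro}$ be the category of finite-dimensional projective left $C$-modules, and for $* \in \{b, +, -, \emptyset\}$ let $\mathsf{Hot}^*(C\text{-}\mathsf{pro})$ be the homotopy category of cochain complexes over $C\text{-}\mathsf{pro}$ that are bounded, bounded below, bounded above, or arbitrary, respectively. Let $\mathsf{Tri}^*(A)$ be the following category of triples. Its objects are triples $(Y^\bullet, V^\bullet, \theta)$, where $Y^\bullet$ is an object of $\mathsf{Hot}^*(H\text{-}\mathsf{pro})$, $V^\bullet$ is an object of $\mathsf{Hot}^*(\bar A\text{-}\mathsf{pro})$ and $\theta : \bar H \otimes_{\bar A} V^\bullet \to \bar H \otimes_H Y^\bullet$ is an isomorphism in $\mathsf{Hot}^*(\bar H\text{-}\mathsf{pro})$. A morphism $(Y_1^\bullet, V_1^\bullet,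 \theta_1) \to (Y_2^\bullet, V_2^\bullet, \theta_2)$ is a pair of morphisms $g : Y_1^\bullet \to Y_2^\bullet$ in $\mathsf{Hot}^*(H\text{-}\mathsf{pro})$ and $h : V_1^\bullet \to V_2^\bullet$ in $\mathsf{Hot}^*(\bar A\text{-}\mathsf{pro})$ such that $\theta_2 \circ (\mathrm{id} \otimes h) = (\mathrm{id} \otimes g) \circ \theta_1$ in $\mathsf{Hot}^*(\bar H\text{-}\mathsf{pro})$. Then, for each $* \in \{b, +, -, \emptyset\}$, the functor $$\mathsf{E} : \mathsf{Hot}^*(A\text{-}\mathsf{pro}) \to \mathsf{Tri}^*(A), \qquad X^\bullet \mapsto \bigl(H \otimes_A X^\bullet,\ \bar A \otimes_A X^\bullet,\ \theta_{X^\bullet}\bigr),$$ where $\theta_{X^\bullet} : \bar H \otimes_{\bar A} (\bar A \otimes_A X^\bullet) \to \bar H \otimes_H (H \otimes_A X^\bullet)$ is the canonical isomorphism, has the following properties: 1. $\mathsf{E}$ is full and essentially surjective. 2. For all objects $X_1^\bullet, X_2^\bullet$ one has $\mathsf{E}(X_1^\bullet) \cong \mathsf{E}(X_2^\bullet)$ if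 and only if $X_1^\bullet \cong X_2^\bullet$. 3. For every object $X^\bullet$, the object $\mathsf{E}(X^\bullet)$ is indecomposable (i.e. non-zero and not isomorphic to a direct sum of two non-zero objects) if and only if $X^\bullet$ is indecomposable. -/

import Mathlib

open CategoryTheory CategoryTheory.Limits
open scoped TensorProduct

universe u v w

noncomputable section

namespace TriplesCat

/-! ### Extension of scalars along a homomorphism of (noncommutative) rings -/

section BaseChange

variable {R S T : Type u} [Ring R] [Ring S] [Ring T]

/-- The balancing relations `(s * f r) ⊗ m = s ⊗ (r • m)`. -/
def balancing (f : R →+* S) (M : Type u) [AddCommGroup M] [Module R M] :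
    Submodule S (S ⊗[ℤ] M) :=
  Submodule.span S
    {x | ∃ (s : S) (r : R) (m : M), x = (s * f r) ⊗ₜ[ℤ] m - s ⊗ₜ[ℤ] (r • m)}

/-- The left `S`-module `S ⊗_R M`, where `S` is regarded as a right `R`-module through `f`:
the quotient of `S ⊗_ℤ M` by the balancing relations. -/
abbrev BaseChange (f : R →+* S) (M : Type u) [AddCommGroup M] [Module R M] : Type u :=
  (S ⊗[ℤ] M) ⧸ balancing f M

namespace BaseChange

variable (f : R →+* S) {M N : Type u} [AddCommGroup M] [Module R M] [AddCommGroup N] [Module R N]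

/-- The elementary tensor `s ⊗ m` in `S ⊗_R M`. -/
def tmul (s : S) (m : M) : BaseChange f M := (balancing f M).mkQ (s ⊗ₜ[ℤ] m)

lemma smul_tmul' (t s : S) (m : M) : t • tmul f s m = tmul f (t * s) m := by
  rw [tmul, ← map_smul]; rfl

lemma tmul_mul (s : S) (r : R) (m : M) : tmul f (s * f r) m = tmul f s (r • m) := by
  rw [tmul, tmul, ← sub_eq_zero, ← map_sub]
  exact (Submodule.Quotient.mk_eq_zero _).2 (Submodule.subset_span ⟨s, r, m, rfl⟩)

lemma tmul_add (s : S) (m n : M) : tmul f s (m + n) = tmul f s m + tmul f s n := by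
  simp [tmul, TensorProduct.tmul_add]

lemma add_tmul (s t : S) (m : M) : tmul f (s + t) m = tmul f s m + tmul f t m := by
  simp [tmul, TensorProduct.add_tmul]

lemma one_tmul_smul (r : R) (m : M) : tmul f 1 (r • m) = f r • tmul f 1 m := by
  rw [← tmul_mul, smul_tmul']; simp

lemma tmul_eq_smul (s : S) (m : M) : tmul f s m = s • tmul f 1 m := by
  rw [smul_tmul', mul_one]

variable {f} in
lemma ext {P : Type w} [AddCommGroup P] [Module S P] {a b : BaseChange f M →ₗ[S] P}
    (h : ∀ m, a (tmul f 1 m) = b (tmul f 1 m)) : a = b := by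
  apply Submodule.linearMap_qext
  apply TensorProduct.AlgebraTensorModule.ext
  intro s m
  have := congrArg (s • ·) (h m)
  simp only [← map_smul, smul_tmul', mul_one] at this
  exact this

/-- The `S`-linear map `S ⊗_R M → P` extending an `R`-semilinear map `M → P`. -/
def lift {P : Type w} [AddCommGroup P] [Module S P] (φ : M →ₛₗ[f] P) :
    BaseChange f M →ₗ[S] P :=
  (balancing f M).liftQ
    (TensorProduct.AlgebraTensorModule.lift
      (LinearMap.toSpanSingleton S (M →ₗ[ℤ] P) φ.toAddMonoidHom.toIntLinearMap))
    (by
      rw [balancing, Submodule.span_le]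
      rintro _ ⟨s, r, m, rfl⟩
      simp [mul_smul])

@[simp] lemma lift_tmul {P : Type w} [AddCommGroup P] [Module S P] (φ : M →ₛₗ[f] P)
    (s : S) (m : M) : lift f φ (tmul f s m) = s • φ m := by
  simp [lift, tmul]

/-- The canonical semilinear map `M → S ⊗_R M`, `m ↦ 1 ⊗ m`. -/
def unit : M →ₛₗ[f] BaseChange f M where
  toFun m := tmul f 1 m
  map_add' := tmul_add f 1
  map_smul' := one_tmul_smul f

@[simp] lemma unit_apply (m : M) : unit f m = tmul f 1 m := rfl

/-- Functoriality: `s ⊗ m ↦ s ⊗ φ m`. -/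
def map (φ : M →ₗ[R] N) : BaseChange f M →ₗ[S] BaseChange f N :=
  lift f ((unit f).comp φ)

@[simp] lemma map_tmul (φ : M →ₗ[R] N) (s : S) (m : M) :
    map f φ (tmul f s m) = tmul f s (φ m) := by
  simp [map, smul_tmul']

instance finite [Module.Finite R M] : Module.Finite S (BaseChange f M) := by
  obtain ⟨t, ht⟩ := (Module.finite_def.1 ‹Module.Finite R M› : (⊤ : Submodule R M).FG)
  refine Module.finite_def.2 (Submodule.fg_def.2
    ⟨(unit f) '' (t : Set M), t.finite_toSet.image _, ?_⟩)
  set U := Submodule.span S ((unit f) '' (t : Set M)) with hU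
  have key : ∀ m : M, tmul f 1 m ∈ U := by
    intro m
    have hm : m ∈ Submodule.span R (t : Set M) := ht ▸ Submodule.mem_top
    induction hm using Submodule.span_induction with
    | mem x hx => exact Submodule.subset_span ⟨x, hx, rfl⟩
    | zero => rw [← unit_apply, map_zero]; exact U.zero_mem
    | add x y _ _ hx hy => rw [tmul_add]; exact U.add_mem hx hy
    | smul r x _ hx => rw [one_tmul_smul]; exact U.smul_mem _ hx
  have h : U.mkQ = 0 := ext fun m => by simpa using key m
  rw [← Submodule.ker_mkQ U, h, LinearMap.ker_zero]

instance projective [Module.Projective R M] : Module.Projective S (BaseChange f M) := by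
  refine Module.Projective.of_lifting_property fun {P Q} _ _ _ _ p g hp => ?_
  let : Module R P := Module.compHom P f
  let : Module R Q := Module.compHom Q f
  let p' : P →ₗ[R] Q := { toFun := p, map_add' := p.map_add, map_smul' := fun r x => p.map_smul (f r) x }
  let g' : M →ₗ[R] Q :=
    { toFun := fun m => g (tmul f 1 m)
      map_add' := fun x y => by rw [tmul_add, map_add]
      map_smul' := fun r x => by rw [one_tmul_smul, map_smul]; rfl }
  obtain ⟨h, hh⟩ := Module.projective_lifting_property p' g' hp
  let h' : M →ₛₗ[f] P :=
    { toFun := h, map_add' := h.map_add, map_smul' := fun r x => h.map_smul r x }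
  refine ⟨lift f h', ext fun m => ?_⟩
  have := LinearMap.congr_fun hh m
  simp only [LinearMap.comp_apply, lift_tmul, one_smul]
  exact this

lemma span_range_unit : Submodule.span S (Set.range (unit f : M → BaseChange f M)) = ⊤ := by
  set U := Submodule.span S (Set.range (unit f : M → BaseChange f M))
  have h : U.mkQ = 0 := ext fun m => by
    simpa using Submodule.subset_span (Set.mem_range_self (f := (unit f : M → _)) m)
  rw [← Submodule.ker_mkQ U, h, LinearMap.ker_zero]

/-- The `g`-semilinear map `S ⊗_R M → T ⊗_R M`, `s ⊗ m ↦ g s ⊗ m`. -/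
def mapRing (g : S →+* T) (h : R →+* T) (w : g.comp f = h) (M : Type u) [AddCommGroup M]
    [Module R M] : BaseChange f M →ₛₗ[g] BaseChange h M :=
  letI : Module S (BaseChange h M) := Module.compHom _ g
  let φ : M →ₛₗ[f] BaseChange h M :=
    { toFun := fun m => tmul h 1 m
      map_add' := tmul_add h 1
      map_smul' := fun r m => (one_tmul_smul h r m).trans
        (congrArg (fun t : T => t • tmul h 1 m) (RingHom.congr_fun w r).symm) }
  { toFun := lift f φ
    map_add' := (lift f φ).map_add
    map_smul' := (lift f φ).map_smul }

@[simp] lemma mapRing_tmul (g : S →+* T) (h : R →+* T) (w : g.comp f = h) (s : S) (m : M) :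
    mapRing f g h w M (tmul f s m) = tmul h (g s) m := by
  rw [tmul_eq_smul h]
  let : Module S (BaseChange h M) := Module.compHom _ g
  exact lift_tmul f _ s m

/-- The canonical isomorphism `T ⊗_S (S ⊗_R M) ≅ T ⊗_R M`, `t ⊗ (s ⊗ m) ↦ (t * g s) ⊗ m`. -/
def comp (g : S →+* T) (h : R →+* T) (w : g.comp f = h) (M : Type u) [AddCommGroup M]
    [Module R M] : BaseChange g (BaseChange f M) ≃ₗ[T] BaseChange h M :=
  LinearEquiv.ofLinearMap
    (lift g (mapRing f g h w M))
    (lift h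
      { toFun := fun m => tmul g 1 (tmul f 1 m)
        map_add' := fun m n => by rw [tmul_add, tmul_add]
        map_smul' := fun r m => by rw [one_tmul_smul, one_tmul_smul, ← w]; rfl })
    (ext fun m => by simp)
    (by
      apply ext
      intro x
      induction (span_range_unit f (M := M)).ge (Submodule.mem_top (x := x))
        using Submodule.span_induction with
      | mem x hx => obtain ⟨m, rfl⟩ := hx; simp
      | zero => rw [← unit_apply, map_zero, map_zero, map_zero]
      | add x y _ _ hx hy => rw [tmul_add, map_add, map_add, hx, hy]
      | smul s x _ hx => rw [one_tmul_smul, map_smul, map_smul, hx])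

@[simp] lemma comp_tmul (g : S →+* T) (h : R →+* T) (w : g.comp f = h) (t : T) (s : S) (m : M) :
    comp f g h w M (tmul g t (tmul f s m)) = tmul h (t * g s) m := by
  simp [comp, smul_tmul']

lemma comp_naturality (g : S →+* T) (h : R →+* T) (w : g.comp f = h) (φ : M →ₗ[R] N) :
    (comp f g h w N).toLinearMap ∘ₗ map g (map f φ) =
      map h φ ∘ₗ (comp f g h w M).toLinearMap := by
  apply ext
  intro x
  induction (span_range_unit f (M := M)).ge (Submodule.mem_top (x := x))
    using Submodule.span_induction with
  | mem x hx => obtain ⟨m, rfl⟩ := hx; simp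
  | zero => rw [← unit_apply]; simp only [map_zero]
  | add x y _ _ hx hy => rw [tmul_add]; simp only [map_add, hx, hy]
  | smul s x _ hx => rw [one_tmul_smul]; simp only [map_smul, hx]

end BaseChange

end BaseChange

/-! ### Finite-dimensional projective modules -/

/-- Finitely generated projective left modules. Over a finite-dimensional algebra, "finitely
generated" is the same as "finite-dimensional", see `finite_iff_finiteDimensional`. -/
def fgProj (R : Type u) [Ring R] : ObjectProperty (ModuleCat.{u} R) :=
  fun M => Module.Finite R M ∧ Module.Projective R M

lemma finite_iff_finiteDimensional (k : Type v) [Field k] (R : Type u) [Ring R] [Algebra k R]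
    [FiniteDimensional k R] (M : Type u) [AddCommGroup M] [Module R M] [Module k M]
    [IsScalarTower k R M] : Module.Finite R M ↔ FiniteDimensional k M :=
  ⟨fun _ => Module.Finite.trans R M, fun _ => Module.Finite.of_restrictScalars_finite k R M⟩

/-- The category `R-pro`. -/
abbrev Pro (R : Type u) [Ring R] := (fgProj R).FullSubcategory

instance (R : Type u) [Ring R] (P : Pro R) : Module.Finite R P.obj := P.property.1
instance (R : Type u) [Ring R] (P : Pro R) : Module.Projective R P.obj := P.property.2

instance (R : Type u) [Ring R] : HasBinaryBiproducts (Pro R) where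
  has_binary_biproduct P Q := hasBinaryBiproduct_of_total
    { pt := ⟨ModuleCat.of R (P.obj × Q.obj), inferInstanceAs (Module.Finite R (P.obj × Q.obj)),
        inferInstanceAs (Module.Projective R (P.obj × Q.obj))⟩
      fst := ObjectProperty.homMk (ModuleCat.ofHom (LinearMap.fst R P.obj Q.obj))
      snd := ObjectProperty.homMk (ModuleCat.ofHom (LinearMap.snd R P.obj Q.obj))
      inl := ObjectProperty.homMk (ModuleCat.ofHom (LinearMap.inl R P.obj Q.obj))
      inr := ObjectProperty.homMk (ModuleCat.ofHom (LinearMap.inr R P.obj Q.obj))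
      inl_fst := by ext; rfl
      inl_snd := by ext; rfl
      inr_fst := by ext; rfl
      inr_snd := by ext; rfl }
    (by
      ext : 2
      refine LinearMap.ext fun x => Prod.ext ?_ ?_
      · exact add_zero _
      · exact zero_add _)

section ExtendPro

variable {R S T : Type u} [Ring R] [Ring S] [Ring T]

/-- The functor `S ⊗_R - : R-pro ⥤ S-pro`. -/
def extendPro (f : R →+* S) : Pro R ⥤ Pro S where
  obj P := ⟨ModuleCat.of S (BaseChange f P.obj), BaseChange.finite f, BaseChange.projective f⟩
  map φ := ObjectProperty.homMk (ModuleCat.ofHom (BaseChange.map f φ.hom.hom))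
  map_id P := by
    ext : 2
    exact BaseChange.ext fun m => BaseChange.map_tmul f _ _ _
  map_comp φ ψ := by
    ext : 2
    exact BaseChange.ext fun m => by simp

instance (f : R →+* S) : (extendPro f).Additive where
  map_add {P Q φ ψ} := by
    ext : 2
    exact BaseChange.ext fun m => by
      change BaseChange.map f (φ.hom.hom + ψ.hom.hom) _ =
        (BaseChange.map f φ.hom.hom + BaseChange.map f ψ.hom.hom) _
      simp [BaseChange.tmul_add]

/-- The canonical isomorphism of functors `T ⊗_S (S ⊗_R -) ≅ T ⊗_R -`. -/
def extendProComp (f : R →+* S) (g : S →+* T) (h : R →+* T) (w : g.comp f = h) :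
    extendPro f ⋙ extendPro g ≅ extendPro h :=
  NatIso.ofComponents
    (fun P => ObjectProperty.isoMk _ (BaseChange.comp f g h w P.obj).toModuleIso)
    (fun {P Q} φ => by
      ext : 2
      exact BaseChange.comp_naturality f g h w φ.hom.hom)

end ExtendPro

/-! ### The homotopy categories -/

/-- The four boundedness types `b`, `+`, `-`, `∅`. -/
inductive Bdd
  | b
  | plus
  | minus
  | none

/-- The boundedness condition on a cochain complex: bounded below for `+`, bounded above for `-`,
both for `b`, no condition for `∅`. -/
def IsBdd {V : Type v} [Category.{w} V] [HasZeroMorphisms V] (K : CochainComplex V ℤ) :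
    Bdd → Prop
  | .plus => ∃ n : ℤ, ∀ i < n, IsZero (K.X i)
  | .minus => ∃ n : ℤ, ∀ i > n, IsZero (K.X i)
  | .b => (∃ n : ℤ, ∀ i < n, IsZero (K.X i)) ∧ ∃ n : ℤ, ∀ i > n, IsZero (K.X i)
  | .none => True

section Hot

variable (V : Type v) [Category.{w} V] [Preadditive V]

/-- Complexes with the given boundedness type, as objects of the homotopy category. -/
def bddComplexes (s : Bdd) : ObjectProperty (HomotopyCategory V (ComplexShape.up ℤ)) :=
  fun K => IsBdd K.as s

/-- The category `Hot^*(V)` of complexes over `V` with boundedness condition `*`, and homotopy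
classes of morphisms of complexes. -/
abbrev Hot (s : Bdd) := (bddComplexes V s).FullSubcategory

variable {V}

lemma IsBdd.of_isZero {W : Type*} [Category* W] [HasZeroMorphisms W] {K : CochainComplex V ℤ}
    {L : CochainComplex W ℤ} {s : Bdd} (hK : IsBdd K s)
    (h : ∀ i, IsZero (K.X i) → IsZero (L.X i)) : IsBdd L s := by
  cases s with
  | b => exact ⟨hK.1.imp fun n hn i hi => h i (hn i hi), hK.2.imp fun n hn i hi => h i (hn i hi)⟩
  | plus => exact Exists.imp (fun n hn i hi => h i (hn i hi)) hK
  | minus => exact Exists.imp (fun n hn i hi => h i (hn i hi)) hK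
  | none => trivial

lemma IsBdd.biprod [HasBinaryBiproducts V] {K L : CochainComplex V ℤ} {s : Bdd}
    (hK : IsBdd K s) (hL : IsBdd L s) : IsBdd (K ⊞ L) s := by
  have h (i : ℤ) (h₁ : IsZero (K.X i)) (h₂ : IsZero (L.X i)) : IsZero ((K ⊞ L).X i) :=
    IsZero.of_iso (by
      rw [biprod_isZero_iff]
      exact ⟨h₁, h₂⟩) (HomologicalComplex.biprodXIso K L i)
  have hp : (∃ n : ℤ, ∀ i < n, IsZero (K.X i)) → (∃ n : ℤ, ∀ i < n, IsZero (L.X i)) →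
      ∃ n : ℤ, ∀ i < n, IsZero ((K ⊞ L).X i) := fun ⟨n, hn⟩ ⟨m, hm⟩ =>
    ⟨min n m, fun i hi => h i (hn i (by lia)) (hm i (by lia))⟩
  have hm : (∃ n : ℤ, ∀ i > n, IsZero (K.X i)) → (∃ n : ℤ, ∀ i > n, IsZero (L.X i)) →
      ∃ n : ℤ, ∀ i > n, IsZero ((K ⊞ L).X i) := fun ⟨n, hn⟩ ⟨m, hm⟩ =>
    ⟨max n m, fun i hi => h i (hn i (by lia)) (hm i (by lia))⟩
  cases s with
  | b => exact ⟨hp hK.1 hL.1, hm hK.2 hL.2⟩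
  | plus => exact hp hK hL
  | minus => exact hm hK hL
  | none => trivial

instance [HasBinaryBiproducts V] (s : Bdd) : HasBinaryBiproducts (Hot V s) where
  has_binary_biproduct X Y :=
    let q := HomotopyCategory.quotient V (ComplexShape.up ℤ)
    let K : CochainComplex V ℤ := X.obj.as
    let L : CochainComplex V ℤ := Y.obj.as
    hasBinaryBiproduct_of_total
      { pt := ⟨q.obj (K ⊞ L), IsBdd.biprod X.property Y.property⟩
        fst := ObjectProperty.homMk (q.map biprod.fst)
        snd := ObjectProperty.homMk (q.map biprod.snd)
        inl := ObjectProperty.homMk (q.map biprod.inl)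
        inr := ObjectProperty.homMk (q.map biprod.inr)
        inl_fst := by
          ext : 1
          exact (q.map_comp _ _).symm.trans (by rw [biprod.inl_fst]; exact q.map_id _)
        inl_snd := by
          ext : 1
          exact (q.map_comp _ _).symm.trans (by rw [biprod.inl_snd]; exact q.map_zero _ _)
        inr_fst := by
          ext : 1
          exact (q.map_comp _ _).symm.trans (by rw [biprod.inr_fst]; exact q.map_zero _ _)
        inr_snd := by
          ext : 1
          exact (q.map_comp _ _).symm.trans (by rw [biprod.inr_snd]; exact q.map_id _) }
      (by
        ext : 1
        have h : q.map (biprod.fst : K ⊞ L ⟶ K) ≫ q.map biprod.inl +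
            q.map (biprod.snd : K ⊞ L ⟶ L) ≫ q.map biprod.inr = 𝟙 (q.obj (K ⊞ L)) := by
          rw [← q.map_comp, ← q.map_comp, ← q.map_add, biprod.total, q.map_id]
        exact h)

variable {W : Type*} [Category* W] [Preadditive W]

/-- The functor between homotopy categories induced by an additive functor. -/
def hotMap (F : V ⥤ W) [F.Additive] (s : Bdd) : Hot V s ⥤ Hot W s :=
  ObjectProperty.lift _ (ObjectProperty.ι _ ⋙ F.mapHomotopyCategory (ComplexShape.up ℤ))
    (fun K => IsBdd.of_isZero K.property fun _ h => F.map_isZero h)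

instance (F : V ⥤ W) [F.Additive] (s : Bdd) : (hotMap F s).Additive where
  map_add {X Y f g} := by
    ext : 1
    exact (F.mapHomotopyCategory (ComplexShape.up ℤ)).map_add (f := f.hom) (g := g.hom)

/-- The isomorphism of functors between homotopy categories induced by an isomorphism
`F ⋙ G ≅ K` of additive functors. -/
def hotMapComp {U : Type*} [Category* U] [Preadditive U] {F : V ⥤ W} {G : W ⥤ U} {K : V ⥤ U}
    [F.Additive] [G.Additive] [K.Additive] (e : F ⋙ G ≅ K) (s : Bdd) :
    hotMap F s ⋙ hotMap G s ≅ hotMap K s :=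
  NatIso.ofComponents
    (fun X => ObjectProperty.isoMk _
      ((Functor.mapHomotopyCategoryCompIso e (ComplexShape.up ℤ)).app X.obj))
    (fun f => by
      ext : 1
      exact (Functor.mapHomotopyCategoryCompIso e (ComplexShape.up ℤ)).hom.naturality f.hom)

end Hot

/-! ### Comma categories of additive functors and the category of triples -/

section Triples

variable {𝒜 ℬ 𝒯 : Type*} [Category* 𝒜] [Category* ℬ] [Category* 𝒯] [Preadditive 𝒜] [Preadditive ℬ]
  [Preadditive 𝒯] (L : 𝒜 ⥤ 𝒯) (R : ℬ ⥤ 𝒯) [L.Additive] [R.Additive]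

/-- Componentwise addition of morphisms in the comma category of a pair of additive functors. -/
instance commaPreadditive : Preadditive (Comma L R) where
  homGroup X Y :=
    { add := fun f g =>
        { left := f.left + g.left
          right := f.right + g.right
          w := by simp [Preadditive.add_comp, Preadditive.comp_add] }
      zero := { left := 0, right := 0, w := by simp }
      sub := fun f g =>
        { left := f.left - g.left
          right := f.right - g.right
          w := by simp [Preadditive.sub_comp, Preadditive.comp_sub] }
      sub_eq_add_neg := fun f g => CommaMorphism.ext (sub_eq_add_neg _ _) (sub_eq_add_neg _ _)
      neg := fun f => { left := -f.left, right := -f.right, w := by simp }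
      add_assoc := fun f g h => CommaMorphism.ext (add_assoc _ _ _) (add_assoc _ _ _)
      zero_add := fun f => CommaMorphism.ext (zero_add _) (zero_add _)
      add_zero := fun f => CommaMorphism.ext (add_zero _) (add_zero _)
      neg_add_cancel := fun f => CommaMorphism.ext (neg_add_cancel _) (neg_add_cancel _)
      add_comm := fun f g => CommaMorphism.ext (add_comm _ _) (add_comm _ _)
      nsmul := nsmulRec
      zsmul := zsmulRec }
  add_comp X Y Z f g h :=
    CommaMorphism.ext (Preadditive.add_comp _ _ _ _ _ _) (Preadditive.add_comp _ _ _ _ _ _)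
  comp_add X Y Z f g h :=
    CommaMorphism.ext (Preadditive.comp_add _ _ _ _ _ _) (Preadditive.comp_add _ _ _ _ _ _)

/-- The objects of the comma category whose structure morphism is an isomorphism. -/
def isoTriples : ObjectProperty (Comma L R) := fun T => IsIso T.hom

/-- The full subcategory of the comma category of `(L, R)` on the triples `(V, Y, θ)`, where
`θ : L V ⟶ R Y` is an isomorphism. -/
abbrev Triples := (isoTriples L R).FullSubcategory

/-- The structure isomorphism of the direct sum of two triples. -/
def sumIso [HasBinaryBiproducts 𝒜] [HasBinaryBiproducts ℬ] [HasBinaryBiproducts 𝒯]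
    (X Y : Triples L R) : L.obj (X.obj.left ⊞ Y.obj.left) ≅ R.obj (X.obj.right ⊞ Y.obj.right) :=
  haveI : IsIso X.obj.hom := X.property
  haveI : IsIso Y.obj.hom := Y.property
  { hom := L.map biprod.fst ≫ X.obj.hom ≫ R.map biprod.inl +
      L.map biprod.snd ≫ Y.obj.hom ≫ R.map biprod.inr
    inv := R.map biprod.fst ≫ inv X.obj.hom ≫ L.map biprod.inl +
      R.map biprod.snd ≫ inv Y.obj.hom ≫ L.map biprod.inr
    hom_inv_id := by
      simp only [Preadditive.add_comp, Preadditive.comp_add, Category.assoc]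
      simp only [← R.map_comp_assoc, biprod.inl_fst, biprod.inl_snd, biprod.inr_fst,
        biprod.inr_snd, R.map_zero, R.map_id, zero_comp, comp_zero, Category.id_comp, add_zero,
        zero_add, IsIso.hom_inv_id_assoc]
      rw [← L.map_comp, ← L.map_comp, ← L.map_add, biprod.total, L.map_id]
    inv_hom_id := by
      simp only [Preadditive.add_comp, Preadditive.comp_add, Category.assoc]
      simp only [← L.map_comp_assoc, biprod.inl_fst, biprod.inl_snd, biprod.inr_fst,
        biprod.inr_snd, L.map_zero, L.map_id, zero_comp, comp_zero, Category.id_comp, add_zero,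
        zero_add, IsIso.inv_hom_id_assoc]
      rw [← R.map_comp, ← R.map_comp, ← R.map_add, biprod.total, R.map_id] }

instance [HasBinaryBiproducts 𝒜] [HasBinaryBiproducts ℬ] [HasBinaryBiproducts 𝒯] :
    HasBinaryBiproducts (Triples L R) where
  has_binary_biproduct X Y :=
    let Z : Triples L R :=
      ⟨⟨X.obj.left ⊞ Y.obj.left, X.obj.right ⊞ Y.obj.right, (sumIso L R X Y).hom⟩,
        inferInstanceAs (IsIso (sumIso L R X Y).hom)⟩
    let p₁ : Z ⟶ X := ObjectProperty.homMk
      { left := biprod.fst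
        right := biprod.fst
        w := by simp [Z, sumIso, ← R.map_comp] }
    let p₂ : Z ⟶ Y := ObjectProperty.homMk
      { left := biprod.snd
        right := biprod.snd
        w := by simp [Z, sumIso, ← R.map_comp] }
    let i₁ : X ⟶ Z := ObjectProperty.homMk
      { left := biprod.inl
        right := biprod.inl
        w := by simp [Z, sumIso, ← L.map_comp_assoc] }
    let i₂ : Y ⟶ Z := ObjectProperty.homMk
      { left := biprod.inr
        right := biprod.inr
        w := by simp [Z, sumIso, ← L.map_comp_assoc] }
    hasBinaryBiproduct_of_total
      { pt := Z
        fst := p₁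
        snd := p₂
        inl := i₁
        inr := i₂
        inl_fst := by ext : 1; exact CommaMorphism.ext biprod.inl_fst biprod.inl_fst
        inl_snd := by ext : 1; exact CommaMorphism.ext biprod.inl_snd biprod.inl_snd
        inr_fst := by ext : 1; exact CommaMorphism.ext biprod.inr_fst biprod.inr_fst
        inr_snd := by ext : 1; exact CommaMorphism.ext biprod.inr_snd biprod.inr_snd }
      (by ext : 1; exact CommaMorphism.ext biprod.total biprod.total)

end Triples

/-! ### The category of triples of an extension of algebras and the functor `E` -/

section Main

variable {k : Type v} [Field k] {H : Type u} [Ring H] [Algebra k H] (A : Subalgebra k H)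

/-- The condition `rad A = rad H`, as subsets of `H`. -/
def SameRadical : Prop :=
  ((↑) : A → H) '' (Ring.jacobson A : Set A) = (Ring.jacobson H : Set H)

/-- The quotient `R / rad R`. -/
abbrev RadQuot (R : Type u) [Ring R] : Type u := R ⧸ Ring.jacobson R

/-- The projection `R → R / rad R`. -/
abbrev radMk (R : Type u) [Ring R] : R →+* RadQuot R := Ideal.Quotient.mk (Ring.jacobson R)

/-- The inclusion `A → H`. -/
abbrev incl : A →+* H := (A.val : A →+* H)

variable {A}

/-- The homomorphism `A / rad A → H / rad H` induced by the inclusion `A ⊂ H`. -/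
def barMap (hrad : SameRadical A) : RadQuot A →+* RadQuot H :=
  Ideal.Quotient.lift (Ring.jacobson A) ((radMk H).comp (incl A)) fun a ha =>
    Ideal.Quotient.eq_zero_iff_mem.2 (hrad.subset ⟨a, ha, rfl⟩)

lemma barMap_comp (hrad : SameRadical A) :
    (barMap hrad).comp (radMk A) = (radMk H).comp (incl A) :=
  RingHom.ext fun _ => rfl

variable (hrad : SameRadical A) (s : Bdd)

/-- The category of triples `Tri^*(A)`. Its objects consist of `V` in `Hot^*(Ā-pro)` (`left`),
`Y` in `Hot^*(H-pro)` (`right`) and an isomorphism `θ : H̄ ⊗_Ā V ⟶ H̄ ⊗_H Y` in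
`Hot^*(H̄-pro)` (`hom`). -/
abbrev Tri :=
  Triples (hotMap (extendPro (barMap hrad)) s) (hotMap (extendPro (radMk H)) s)

/-- The canonical isomorphism `H̄ ⊗_Ā (Ā ⊗_A X) ≅ H̄ ⊗_A X ≅ H̄ ⊗_H (H ⊗_A X)`, natural in `X`
in `Hot^*(A-pro)`. -/
def gluing : hotMap (extendPro (radMk A)) s ⋙ hotMap (extendPro (barMap hrad)) s ≅
    hotMap (extendPro (incl A)) s ⋙ hotMap (extendPro (radMk H)) s :=
  hotMapComp (extendProComp (radMk A) (barMap hrad) _ (barMap_comp hrad)) s ≪≫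
    (hotMapComp (extendProComp (incl A) (radMk H) _ rfl) s).symm

/-- The functor `E : Hot^*(A-pro) ⥤ Tri^*(A)`,
`X ↦ (H ⊗_A X, Ā ⊗_A X, θ_X : H̄ ⊗_Ā (Ā ⊗_A X) ≅ H̄ ⊗_H (H ⊗_A X))`. -/
def E : Hot (Pro A) s ⥤ Tri hrad s where
  obj X :=
    ⟨{ left := (hotMap (extendPro (radMk A)) s).obj X
       right := (hotMap (extendPro (incl A)) s).obj X
       hom := (gluing hrad s).hom.app X },
      inferInstanceAs (IsIso ((gluing hrad s).hom.app X))⟩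
  map f := ObjectProperty.homMk
    { left := (hotMap (extendPro (radMk A)) s).map f
      right := (hotMap (extendPro (incl A)) s).map f
      w := (gluing hrad s).hom.naturality f }
  map_id X := by
    ext : 1
    exact CommaMorphism.ext ((hotMap (extendPro (radMk A)) s).map_id X)
      ((hotMap (extendPro (incl A)) s).map_id X)
  map_comp f g := by
    ext : 1
    exact CommaMorphism.ext ((hotMap (extendPro (radMk A)) s).map_comp f g)
      ((hotMap (extendPro (incl A)) s).map_comp f g)

end Main

end TriplesCat

end

noncomputable section

namespace TriplesCat

/-! Because `rad H` lies in `A`, the algebra `A` is the fibre product of `Ā` and `H` over `H̄`.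
Morphisms of projective modules inherit this: a map over `A` is the same as a pair of maps over `Ā`
and `H` that agree over `H̄` (`exists_lift`). In homotopy categories a pair agrees only up to
homotopy, and this is what has to be overcome.

The remedy is minimal complexes, those whose differential vanishes modulo the radical. Every complex
is homotopy equivalent to a minimal one with the same boundedness (`exists_minimal`). The reduction
of a minimal complex has zero differential, so homotopies between reduced maps vanish and an
isomorphism of reductions in the homotopy category is one in each degree (`hotHom_injective`,
`isIso_f_of_isIso_hotHom`).

Hence a morphism of triples between minimal complexes is compatible on the nose and glues
degreewise, which gives fullness (`toTriples_map_surjective`). For a triple with `Y` minimal and `V`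
of zero differential, the components of `θ` lift to isomorphisms along which the differential of `Y`
is transported. The result has entries in the radical, so it is defined over `A`; this gives
essential surjectivity (`exists_toTriples_obj_iso`). Finally, a map of projectives that is
invertible modulo the nilpotent radical is invertible, so `X ↦ Ā ⊗_A X`, and with it `E`, reflects
isomorphisms. Statements 2 and 3 follow formally from these three properties. -/

/-! ### Idempotents modulo nilpotents -/

/-- If `x ^ 2 - x` is nilpotent, then there is an idempotent that is a multiple of `x` and whose
complement is a multiple of `1 - x`. -/
lemma exists_idempotent_mul_of_isNilpotent {R : Type*} [Ring R] (x : R)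
    (hx : IsNilpotent (x ^ 2 - x)) :
    ∃ u v : R, IsIdempotentElem (x * u) ∧ 1 - x * u = v * (1 - x) := by
  open Polynomial in
  obtain ⟨n, hn⟩ := hx
  -- The idempotent is the summand `a * X ^ (n + 1)` of the Bézout identity. The exponent `n + 1`,
  -- rather than `n`, leaves a factor `X`, respectively `1 - X`, to split off even when `n = 0`.
  have hc : IsCoprime ((X : ℤ[X]) ^ (n + 1)) ((1 - X) ^ (n + 1)) :=
    IsCoprime.pow ⟨1, 1, by ring⟩
  obtain ⟨a, b, hab⟩ := hc
  have h0 : aeval x ((X * (1 - X) : ℤ[X]) ^ (n + 1)) = 0 := by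
    have : (X * (1 - X) : ℤ[X]) = -(X ^ 2 - X) := by ring
    rw [this, map_pow, map_neg, neg_pow, map_sub, map_pow, aeval_X, pow_succ (x ^ 2 - x), hn,
      zero_mul, mul_zero]
  have h1 : 1 - x * aeval x (X ^ n * a) = aeval x (b * (1 - X) ^ n) * (1 - x) := by
    have : 1 - X * (X ^ n * a) = b * (1 - X) ^ n * (1 - X) := by linear_combination -hab
    simpa using congrArg (aeval x) this
  refine ⟨aeval x (X ^ n * a), aeval x (b * (1 - X) ^ n), ?_, h1⟩
  have h2 : X * (X ^ n * a) * (1 - X * (X ^ n * a)) = (a * b) * (X * (1 - X)) ^ (n + 1) := by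
    rw [mul_pow]
    linear_combination -(X * (X ^ n * a)) * hab
  have h3 := congrArg (aeval x) h2
  rw [map_mul _ (a * b), h0, mul_zero] at h3
  simp only [map_mul, map_sub, aeval_X, mul_sub, mul_one, sub_eq_zero] at h3 ⊢
  exact h3.symm

/-! ### Complexes in the homotopy categories -/

section Hot

variable {V : Type*} [Category* V] [Preadditive V] {W : Type*} [Category* W] [Preadditive W]
  {s : Bdd}

/-- A complex satisfying a boundedness condition, as an object of the homotopy category. -/
abbrev hotOf (K : CochainComplex V ℤ) (hK : IsBdd K s) : Hot V s :=
  ⟨(HomotopyCategory.quotient V _).obj K, hK⟩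

/-- The class of a morphism of complexes. -/
def hotHom {K L : CochainComplex V ℤ} (hK : IsBdd K s) (hL : IsBdd L s) (f : K ⟶ L) :
    hotOf K hK ⟶ hotOf L hL :=
  ObjectProperty.homMk ((HomotopyCategory.quotient V _).map f)

variable {K L M : CochainComplex V ℤ} (hK : IsBdd K s) (hL : IsBdd L s) (hM : IsBdd M s)

lemma hotHom_surjective : Function.Surjective (hotHom hK hL) := fun f => by
  obtain ⟨g, hg⟩ := (HomotopyCategory.quotient V _).map_surjective f.hom
  exact ⟨g, by ext : 1; exact hg⟩

@[simp] lemma hotHom_id : hotHom hK hK (𝟙 K) = 𝟙 _ := by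
  ext : 1
  exact (HomotopyCategory.quotient V _).map_id K

@[simp] lemma hotHom_comp (f : K ⟶ L) (g : L ⟶ M) :
    hotHom hK hM (f ≫ g) = hotHom hK hL f ≫ hotHom hL hM g := by
  ext : 1
  exact (HomotopyCategory.quotient V _).map_comp f g

lemma hotHom_eq_iff (f g : K ⟶ L) : hotHom hK hL f = hotHom hK hL g ↔ Nonempty (Homotopy f g) := by
  refine ⟨fun h => ⟨HomotopyCategory.homotopyOfEq _ _ (congrArg (·.hom) h)⟩, fun ⟨h⟩ => ?_⟩
  ext : 1
  exact HomotopyCategory.eq_of_homotopy _ _ h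

/-- With zero differentials, both terms `d h` and `h d` of a homotopy vanish. -/
lemma hotHom_injective (hK' : ∀ i j, K.d i j = 0) (hL' : ∀ i j, L.d i j = 0) :
    Function.Injective (hotHom hK hL) := fun f g h => by
  obtain ⟨w⟩ := (hotHom_eq_iff hK hL f g).1 h
  ext i
  have := w.comm i
  simpa [dNext, prevD, hK', hL'] using this

/-- An isomorphism of complexes induces an isomorphism in the homotopy category. -/
@[simps] def hotIso (f : K ≅ L) : hotOf K hK ≅ hotOf L hL where
  hom := hotHom hK hL f.hom
  inv := hotHom hL hK f.inv
  hom_inv_id := by rw [← hotHom_comp, f.hom_inv_id, hotHom_id]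
  inv_hom_id := by rw [← hotHom_comp, f.inv_hom_id, hotHom_id]

lemma isIso_hotHom {f : K ⟶ L} (h : ∀ i, IsIso (f.f i)) : IsIso (hotHom hK hL f) := by
  have : IsIso f := HomologicalComplex.Hom.isIso_of_components f
  exact (hotIso hK hL (asIso f)).isIso_hom

lemma isIso_f_of_isIso_hotHom (hK' : ∀ i j, K.d i j = 0) (hL' : ∀ i j, L.d i j = 0) (f : K ⟶ L)
    [IsIso (hotHom hK hL f)] (i : ℤ) : IsIso (f.f i) := by
  obtain ⟨g, hg⟩ := hotHom_surjective hL hK (inv (hotHom hK hL f))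
  have h₁ : f ≫ g = 𝟙 K := hotHom_injective hK hK hK' hK' (by simp [hotHom_comp hK hL hK, hg])
  have h₂ : g ≫ f = 𝟙 L := hotHom_injective hL hL hL' hL' (by simp [hotHom_comp hL hK hL, hg])
  exact ⟨g.f i, by rw [← HomologicalComplex.comp_f, h₁, HomologicalComplex.id_f],
    by rw [← HomologicalComplex.comp_f, h₂, HomologicalComplex.id_f]⟩

lemma IsBdd.map (F : V ⥤ W) [F.Additive] {K : CochainComplex V ℤ} (hK : IsBdd K s) :
    IsBdd ((F.mapHomologicalComplex _).obj K) s :=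
  hK.of_isZero fun _ h => F.map_isZero h

lemma hotMap_map_hotHom (F : V ⥤ W) [F.Additive] (f : K ⟶ L) :
    (hotMap F s).map (hotHom hK hL f) =
      hotHom (hK.map F) (hL.map F) ((F.mapHomologicalComplex _).map f) := rfl

end Hot

/-! ### Minimal complexes -/

section Radical

variable {C D : Type*} [Category* C] [Category* D] [Preadditive C] [Preadditive D]

omit [Preadditive C] [Preadditive D] in
lemma map_end_pow (F : C ⥤ D) {X : C} (f : End X) (n : ℕ) :
    F.map (f ^ n) = End.of (F.map f) ^ n :=
  map_pow (F.mapEnd X) f n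

/-- If `φ ≫ φ - φ` is nilpotent, then there is an idempotent that factors through `φ` and whose
complement factors through `𝟙 X - φ`. -/
lemma exists_idempotent_comp_of_isNilpotent {X : C} (φ : X ⟶ X)
    (h : IsNilpotent (End.of (φ ≫ φ - φ))) :
    ∃ u v : X ⟶ X, (u ≫ φ) ≫ (u ≫ φ) = u ≫ φ ∧ 𝟙 X - u ≫ φ = (𝟙 X - φ) ≫ v :=
  -- Multiplication in `End X` is composition in reverse order: `x * u` is `u ≫ φ`.
  exists_idempotent_mul_of_isNilpotent (End.of φ) (by rw [pow_two]; exact h)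

/-- A full functor onto a von Neumann regular category, whose kernel is nilpotent, uniformly on
all endomorphism rings. -/
structure IsRadicalQuotient (F : C ⥤ D) : Prop where
  full : F.Full
  regular : ∀ ⦃P Q : D⦄ (d : P ⟶ Q), ∃ h : Q ⟶ P, d ≫ h ≫ d = d
  nilpotent : ∃ N : ℕ, ∀ (P : C) (f : End P), F.map f = 0 → f ^ N = 0

namespace IsRadicalQuotient

/-- For this quotient, minimal means zero differential; it is applied to `Ā-pro`. -/
lemma id (h : ∀ ⦃P Q : C⦄ (d : P ⟶ Q), ∃ h : Q ⟶ P, d ≫ h ≫ d = d) :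
    IsRadicalQuotient (𝟭 C) where
  full := inferInstance
  regular := h
  nilpotent := ⟨1, fun P f hf => by simpa using hf⟩

variable {F : C ⥤ D} [F.Additive] (hF : IsRadicalQuotient F)
include hF

/-- Here `1 - f` lies in the kernel of `F`, so it is nilpotent. -/
lemma isIso_of_map_eq_id {P : C} (f : P ⟶ P) (hf : F.map f = 𝟙 _) : IsIso f := by
  obtain ⟨N, hN⟩ := hF.nilpotent
  have h0 : IsNilpotent (1 - End.of f) :=
    ⟨N, hN P _ ((F.map_sub (f := 𝟙 P) (g := f)).trans (by rw [F.map_id, hf, sub_self]))⟩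
  have := h0.isUnit_one_sub
  rw [sub_sub_cancel] at this
  exact (isUnit_iff_isIso f).1 this

lemma isIso_of_isIso_map {P Q : C} (f : P ⟶ Q) [IsIso (F.map f)] : IsIso f := by
  have := hF.full
  obtain ⟨g, hg⟩ := F.map_surjective (inv (F.map f))
  have h₁ : IsIso (f ≫ g) := hF.isIso_of_map_eq_id _ (by simp [hg])
  have h₂ : IsIso (g ≫ f) := hF.isIso_of_map_eq_id _ (by simp [hg])
  have : IsSplitMono f := ⟨⟨⟨g ≫ inv (f ≫ g), by rw [← Category.assoc, IsIso.hom_inv_id]⟩⟩⟩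
  have : IsSplitEpi f := ⟨⟨⟨inv (g ≫ f) ≫ g, by rw [Category.assoc, IsIso.inv_hom_id]⟩⟩⟩
  exact isIso_of_epi_of_isSplitMono f

lemma isZero_of_isZero_map {P : C} (h : IsZero (F.obj P)) : IsZero P := by
  have : IsIso (F.map (0 : P ⟶ P)) := ⟨0, h.eq_of_src _ _, h.eq_of_src _ _⟩
  have := hF.isIso_of_isIso_map (0 : P ⟶ P)
  rw [IsZero.iff_id_eq_zero, ← IsIso.hom_inv_id (0 : P ⟶ P), zero_comp]

variable [IsIdempotentComplete C] {s : Bdd}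

/-- Every retract of an object in the image lies in the essential image. -/
lemma exists_iso_of_retract {P : C} {Q : D} (i : Q ⟶ F.obj P) (r : F.obj P ⟶ Q)
    (hir : i ≫ r = 𝟙 Q) : ∃ P' : C, Nonempty (F.obj P' ≅ Q) := by
  have := hF.full
  obtain ⟨N, hN⟩ := hF.nilpotent
  obtain ⟨f, hf⟩ := F.map_surjective (r ≫ i)
  have hff : F.map (f ≫ f) = F.map f := by simp [hf, reassoc_of% hir]
  have hnil : IsNilpotent (End.of (f ≫ f - f)) :=
    ⟨N, hN P _ ((F.map_sub (f := f ≫ f) (g := f)).trans (by rw [hff, sub_self]))⟩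
  -- Put `e = u ≫ f`. The images of `e` and `f` under `F` need not coincide, but they satisfy `ef =
  -- e` and `fe = f` (`h₁`, `h₂`), which suffices for their splittings to be isomorphic.
  obtain ⟨u, v, he, huv⟩ := exists_idempotent_comp_of_isNilpotent f hnil
  obtain ⟨P', a, b, hab, hba⟩ := IsIdempotentComplete.idempotents_split P (u ≫ f) he
  have h₁ : F.map (u ≫ f) ≫ F.map f = F.map (u ≫ f) := by
    rw [← F.map_comp, Category.assoc, F.map_comp, hff, ← F.map_comp]
  have h₂ : F.map f ≫ F.map (u ≫ f) = F.map f := by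
    have h' : F.map f ≫ F.map (𝟙 P - u ≫ f) = F.map f ≫ F.map ((𝟙 P - f) ≫ v) := by rw [huv]
    rw [F.map_comp (𝟙 P - f), F.map_sub, F.map_sub, F.map_id, Preadditive.comp_sub,
      Category.comp_id, ← Category.assoc, Preadditive.comp_sub, Category.comp_id,
      ← F.map_comp f f, hff, sub_self, zero_comp, sub_eq_zero] at h'
    exact h'.symm
  rw [← hba] at h₁ h₂
  refine ⟨P', ⟨⟨F.map a ≫ r, i ≫ F.map b, ?_, ?_⟩⟩⟩
  · rw [Category.assoc, ← Category.assoc r, ← hf]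
    have := congrArg (fun g => F.map a ≫ g ≫ F.map b) h₁
    simp only [← F.map_comp, Category.assoc, hab, reassoc_of% hab] at this
    simpa only [← F.map_comp, Category.assoc, Category.comp_id, F.map_id] using this
  · have := congrArg (fun g => i ≫ g ≫ r) h₂
    simp only [hf, F.map_comp, Category.assoc, hir, reassoc_of% hir, Category.comp_id] at this
    simpa using this

/-- Every complex is isomorphic in the homotopy category to a complex whose differential is in
the kernel of a given radical quotient functor. -/
theorem exists_minimal (X : Hot C s) :
    ∃ (K : CochainComplex C ℤ) (hK : IsBdd K s), (∀ i j, F.map (K.d i j) = 0) ∧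
      Nonempty (X ≅ hotOf K hK) := by
  obtain ⟨K, hK⟩ : ∃ (K : CochainComplex C ℤ) (hK : IsBdd K s), X = hotOf K hK :=
    ⟨X.obj.as, X.property, rfl⟩
  obtain ⟨hK, rfl⟩ := hK
  have := hF.full
  obtain ⟨N, hN⟩ := hF.nilpotent
  have hex (i j : ℤ) : ∃ h : K.X i ⟶ K.X j,
      F.map (K.d j i) ≫ F.map h ≫ F.map (K.d j i) = F.map (K.d j i) := by
    obtain ⟨h', hh'⟩ := hF.regular (F.map (K.d j i))
    obtain ⟨h, rfl⟩ := F.map_surjective h'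
    exact ⟨h, hh'⟩
  choose h hh using hex
  -- The map `φ = dh + hd` is null-homotopic and, modulo the kernel of `F`, nearly the projection
  -- onto the contractible part of `K`: there `φd = d` and `φ² - φ = dhhd`.
  let φ : K ⟶ K := Homotopy.nullHomotopicMap' (fun i j _ => h i j)
  have hφ (i : ℤ) : φ.f i = K.d i (i + 1) ≫ h (i + 1) i + h i (i - 1) ≫ K.d (i - 1) i :=
    Homotopy.nullHomotopicMap'_f (k₂ := i - 1) (k₁ := i) (k₀ := i + 1) (by simp) (by simp) _
  have hφd (i : ℤ) : F.map (φ.f i ≫ K.d i (i + 1)) = F.map (K.d i (i + 1)) := by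
    simp [hφ, Preadditive.add_comp, hh]
  have hφ₂ (i : ℤ) : F.map (φ.f i ≫ φ.f i - φ.f i) = F.map (K.d i (i + 1)) ≫
      F.map (h (i + 1) i ≫ h i (i - 1)) ≫ F.map (K.d (i - 1) i) := by
    have h1 : φ.f i ≫ φ.f i = (φ.f i ≫ K.d i (i + 1)) ≫ h (i + 1) i +
        φ.f i ≫ h i (i - 1) ≫ K.d (i - 1) i := by
      conv_lhs => rw [hφ i]
      rw [hφ i]
      simp only [Preadditive.comp_add, Category.assoc]
    have h2 : F.map (h i (i - 1) ≫ K.d (i - 1) i) ≫ F.map (h i (i - 1) ≫ K.d (i - 1) i) =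
        F.map (h i (i - 1) ≫ K.d (i - 1) i) := by
      rw [F.map_comp, Category.assoc, hh]
    rw [h1, F.map_sub, F.map_add, F.map_comp _ (h (i + 1) i), hφd, F.map_comp (φ.f i), hφ i]
    simp only [F.map_add, Preadditive.add_comp, h2]
    simp only [F.map_comp, Category.assoc]
    abel
  have hnil : IsNilpotent (End.of (φ ≫ φ - φ)) := by
    -- The square of `φ² - φ` is killed by `F`, since `d² = 0`; then `N` further factors give zero.
    -- One `N` serves all degrees, so unbounded complexes cause no difficulty.
    refine ⟨2 * N, ?_⟩
    rw [pow_mul]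
    refine HomologicalComplex.hom_ext _ _ fun i => ?_
    refine (map_end_pow (HomologicalComplex.eval C _ i) _ N).trans (hN _ _ ?_)
    have h1 : F.map ((φ.f i ≫ φ.f i - φ.f i) ≫ (φ.f i ≫ φ.f i - φ.f i)) = 0 := by
      rw [F.map_comp, hφ₂]
      simp only [Category.assoc]
      rw [← F.map_comp_assoc (K.d (i - 1) i), K.d_comp_d, F.map_zero, zero_comp, comp_zero,
        comp_zero]
    rw [pow_two]
    exact h1
  obtain ⟨u, v, he, huv⟩ := exists_idempotent_comp_of_isNilpotent φ hnil
  -- The idempotent `u ≫ φ` is null-homotopic like `φ`, so its complementary summand `L` is homotopy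
  -- equivalent to `K`.
  obtain ⟨L, a, b, hab, hba⟩ := IsIdempotentComplete.idempotents_split K (𝟙 K - u ≫ φ)
    (Idempotents.idem_of_id_sub_idem _ he)
  have hab' (i : ℤ) : a.f i ≫ b.f i = 𝟙 _ := by
    rw [← HomologicalComplex.comp_f, hab, HomologicalComplex.id_f]
  have hL : IsBdd L s := hK.of_isZero fun i hi => by
    rw [IsZero.iff_id_eq_zero, ← hab' i, hi.eq_of_tgt (a.f i) 0, zero_comp]
  refine ⟨L, hL, ?_, ⟨⟨hotHom hK hL b, hotHom hL hK a, ?_, ?_⟩⟩⟩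
  · intro i j
    by_cases hij : i + 1 = j
    · subst hij
      -- The complement factors through `1 - φ`, and `(1 - φ)d` is killed by `F` (`hφd`).
      have h1 : L.d i (i + 1) = a.f i ≫ ((𝟙 K - φ).f i ≫ K.d i (i + 1)) ≫
          v.f (i + 1) ≫ b.f (i + 1) := by
        have h2 : a.f i ≫ (b ≫ a).f i ≫ K.d i (i + 1) ≫ b.f (i + 1) = L.d i (i + 1) := by
          rw [HomologicalComplex.comp_f, ← b.comm]
          simp only [Category.assoc]
          rw [reassoc_of% hab' i, reassoc_of% hab' i]
        rw [← h2, hba, huv, HomologicalComplex.comp_f]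
        simp only [Category.assoc]
        rw [v.comm_assoc]
      have h3 : F.map ((𝟙 K - φ).f i ≫ K.d i (i + 1)) = 0 := by
        rw [HomologicalComplex.sub_f_apply, Preadditive.sub_comp, F.map_sub, hφd,
          HomologicalComplex.id_f, Category.id_comp, sub_self]
      rw [h1, F.map_comp, F.map_comp ((𝟙 K - φ).f i ≫ _), h3, zero_comp, comp_zero]
    · rw [L.shape _ _ hij, F.map_zero]
  · rw [← hotHom_comp, hba, ← hotHom_id, hotHom_eq_iff]
    have h1 : Homotopy φ 0 := Homotopy.nullHomotopy' _
    have h2 : Homotopy (𝟙 K - (𝟙 K - u ≫ φ)) 0 :=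
      (Homotopy.ofEq (sub_sub_cancel _ _)).trans ((h1.compLeft u).trans (Homotopy.ofEq comp_zero))
    exact ⟨(Homotopy.equivSubZero.symm h2).symm⟩
  · rw [← hotHom_comp, hab, hotHom_id]

omit [IsIdempotentComplete C] in
-- The reductions have zero differential, so the reduced map is invertible in each degree, and `F`
-- reflects isomorphisms.
lemma isIso_of_isIso_hotMap {K L : CochainComplex C ℤ} (hK : IsBdd K s) (hL : IsBdd L s)
    (hK' : ∀ i j, F.map (K.d i j) = 0) (hL' : ∀ i j, F.map (L.d i j) = 0)
    (f : hotOf K hK ⟶ hotOf L hL) (hf : IsIso ((hotMap F s).map f)) : IsIso f := by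
  obtain ⟨f, rfl⟩ := hotHom_surjective hK hL f
  rw [hotMap_map_hotHom] at hf
  refine isIso_hotHom hK hL fun i => ?_
  have : IsIso (F.map (f.f i)) := @isIso_f_of_isIso_hotHom _ _ _ _ _ _ (hK.map F) (hL.map F) hK' hL'
    ((F.mapHomologicalComplex _).map f) hf i
  exact hF.isIso_of_isIso_map _

/-- A radical quotient functor induces a conservative functor of homotopy categories. -/
lemma reflectsIsomorphisms_hotMap : (hotMap F s).ReflectsIsomorphisms where
  reflects {X Y} f hf := by
    obtain ⟨K, hK, hK', ⟨a⟩⟩ := hF.exists_minimal X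
    obtain ⟨L, hL, hL', ⟨b⟩⟩ := hF.exists_minimal Y
    have h : IsIso (a.inv ≫ f ≫ b.hom) := hF.isIso_of_isIso_hotMap hK hL hK' hL' _ (by
      rw [Functor.map_comp, Functor.map_comp]; infer_instance)
    have : f = a.hom ≫ (a.inv ≫ f ≫ b.hom) ≫ b.inv := by simp
    rw [this]
    infer_instance

end IsRadicalQuotient

end Radical

/-! ### Full, conservative, essentially surjective functors -/

section Detect

variable {C D : Type*} [Category* C] [Category* D] (F : C ⥤ D)

lemma nonempty_iso_iff [F.Full] [F.ReflectsIsomorphisms] (X Y : C) :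
    Nonempty (F.obj X ≅ F.obj Y) ↔ Nonempty (X ≅ Y) := by
  refine ⟨fun ⟨a⟩ => ?_, fun ⟨a⟩ => ⟨F.mapIso a⟩⟩
  obtain ⟨f, hf⟩ := F.map_surjective a.hom
  have : IsIso (F.map f) := hf ▸ a.isIso_hom
  have := isIso_of_reflects_iso f F
  exact ⟨asIso f⟩

variable [Preadditive C] [Preadditive D] [F.Additive]

lemma isZero_map_iff [F.ReflectsIsomorphisms] (X : C) : IsZero (F.obj X) ↔ IsZero X := by
  refine ⟨fun h => ?_, F.map_isZero⟩
  have : IsIso (F.map (0 : X ⟶ X)) := ⟨0, h.eq_of_src _ _, h.eq_of_src _ _⟩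
  have := isIso_of_reflects_iso (0 : X ⟶ X) F
  rw [IsZero.iff_id_eq_zero, ← IsIso.hom_inv_id (0 : X ⟶ X), zero_comp]

/-- A decomposition of `X` is mapped forward because `F` is additive. One of `F.obj X` is pulled
back by choosing preimages of the summands and lifting the isomorphism. -/
lemma indecomposable_map_iff [HasBinaryBiproducts C] [HasBinaryBiproducts D] [F.Full] [F.EssSurj]
    [F.ReflectsIsomorphisms] (X : C) : Indecomposable (F.obj X) ↔ Indecomposable X := by
  have := preservesBinaryBiproducts_of_preservesBiproducts F
  refine and_congr (not_congr (isZero_map_iff F X)) ⟨fun h Y Z a => ?_, fun h Y Z a => ?_⟩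
  · rw [← isZero_map_iff F Y, ← isZero_map_iff F Z]
    exact h _ _ (F.mapIso a ≪≫ F.mapBiprod Y Z)
  · obtain ⟨b⟩ := (nonempty_iso_iff F X (F.objPreimage Y ⊞ F.objPreimage Z)).1
      ⟨a ≪≫ biprod.mapIso (F.objObjPreimageIso Y).symm (F.objObjPreimageIso Z).symm ≪≫
        (F.mapBiprod _ _).symm⟩
    refine (h _ _ b).imp (fun hY => ?_) fun hZ => ?_
    · exact ((isZero_map_iff F _).2 hY).of_iso (F.objObjPreimageIso Y).symm
    · exact ((isZero_map_iff F _).2 hZ).of_iso (F.objObjPreimageIso Z).symm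

end Detect

/-! ### Functors to categories of triples -/

section ToTriples

variable {C 𝒜 ℬ 𝒯 : Type*} [Category* C] [Category* 𝒜] [Category* ℬ] [Category* 𝒯]
  {P : C ⥤ 𝒜} {Q : C ⥤ ℬ} {L : 𝒜 ⥤ 𝒯} {R : ℬ ⥤ 𝒯} (γ : P ⋙ L ≅ Q ⋙ R)

/-- The functor `X ↦ (P X, Q X, γ X)` to the category of triples. -/
def toTriples : C ⥤ Triples L R where
  obj X :=
    ⟨{ left := P.obj X, right := Q.obj X, hom := γ.hom.app X },
      inferInstanceAs (IsIso (γ.hom.app X))⟩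
  map f := ObjectProperty.homMk
    { left := P.map f
      right := Q.map f
      w := γ.hom.naturality f }
  map_id X := by ext : 1; exact CommaMorphism.ext (P.map_id X) (Q.map_id X)
  map_comp f g := by ext : 1; exact CommaMorphism.ext (P.map_comp f g) (Q.map_comp f g)

instance [P.ReflectsIsomorphisms] : (toTriples γ).ReflectsIsomorphisms where
  reflects f _ := by
    have : IsIso (P.map f) :=
      inferInstanceAs (IsIso ((ObjectProperty.ι _ ⋙ Comma.fst L R).map ((toTriples γ).map f)))
    exact isIso_of_reflects_iso f P

instance [Preadditive C] [Preadditive 𝒜] [Preadditive ℬ] [Preadditive 𝒯] [P.Additive]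
    [Q.Additive] [L.Additive] [R.Additive] : (toTriples γ).Additive where
  map_add {_ _ _ _} := by ext : 1; exact CommaMorphism.ext P.map_add Q.map_add

/-- An isomorphism from an object in the image of `toTriples`. -/
def toTriplesObjIso {X : C} (T : Triples L R) (a : P.obj X ≅ T.obj.left)
    (b : Q.obj X ≅ T.obj.right) (h : L.map a.hom ≫ T.obj.hom = γ.hom.app X ≫ R.map b.hom) :
    (toTriples γ).obj X ≅ T :=
  ObjectProperty.isoMk _ (Comma.isoMk a b h)

end ToTriples

/-! ### Squares of radical quotient functors -/

section Square

variable {𝒜 ℋ 𝒜' ℋ' : Type*} [Category* 𝒜] [Category* ℋ] [Category* 𝒜'] [Category* ℋ']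
  [Preadditive 𝒜] [Preadditive ℋ] [Preadditive 𝒜'] [Preadditive ℋ']

/-- Two radical quotient functors, together with faithful functors between their sources and
targets that identify the kernels of the quotient functors. -/
structure IsRadicalSquare (FA : 𝒜 ⥤ 𝒜') (FH : ℋ ⥤ ℋ') (G : 𝒜 ⥤ ℋ) (G' : 𝒜' ⥤ ℋ') : Prop where
  left : IsRadicalQuotient FA
  right : IsRadicalQuotient FH
  essSurj : FA.EssSurj
  faithful : G.Faithful
  faithful' : G'.Faithful
  lift : ∀ ⦃P Q : 𝒜⦄ (ψ : G.obj P ⟶ G.obj Q), FH.map ψ = 0 → ∃ φ : P ⟶ Q, G.map φ = ψ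

/-- A natural transformation between composite functors, applied degreewise to a complex. -/
def glue {FA : 𝒜 ⥤ 𝒜'} {FH : ℋ ⥤ ℋ'} {G : 𝒜 ⥤ ℋ} {G' : 𝒜' ⥤ ℋ'}
    [FA.Additive] [FH.Additive] [G.Additive] [G'.Additive] (e : FA ⋙ G' ⟶ G ⋙ FH)
    (K : CochainComplex 𝒜 ℤ) :
    (G'.mapHomologicalComplex (ComplexShape.up ℤ)).obj ((FA.mapHomologicalComplex _).obj K) ⟶
      (FH.mapHomologicalComplex _).obj ((G.mapHomologicalComplex _).obj K) :=
  (NatTrans.mapHomologicalComplex e _).app K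

namespace IsRadicalSquare

variable {FA : 𝒜 ⥤ 𝒜'} {FH : ℋ ⥤ ℋ'} {G : 𝒜 ⥤ ℋ} {G' : 𝒜' ⥤ ℋ'}
  [FA.Additive] [FH.Additive] [G.Additive] [G'.Additive]
  (h : IsRadicalSquare FA FH G G') (e : FA ⋙ G' ≅ G ⋙ FH)

include h e

omit [FA.Additive] [FH.Additive] [G.Additive] in
lemma map_left_eq_zero {P Q : 𝒜} (φ : P ⟶ Q) (hφ : FH.map (G.map φ) = 0) : FA.map φ = 0 := by
  have := h.faithful'
  apply G'.map_injective
  have := e.hom.naturality φ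
  rw [Functor.comp_map, Functor.comp_map, hφ, comp_zero] at this
  rw [G'.map_zero, ← cancel_mono (e.hom.app Q), this, zero_comp]

omit [Preadditive 𝒜] [Preadditive ℋ] h e [FA.Additive] [FH.Additive] [G.Additive] in
lemma map_right_eq_zero (e : FA ⋙ G' ≅ G ⋙ FH) {P Q : 𝒜} (φ : P ⟶ Q) (hφ : FA.map φ = 0) :
    FH.map (G.map φ) = 0 := by
  have := e.hom.naturality φ
  rw [Functor.comp_map, Functor.comp_map, hφ, G'.map_zero, zero_comp] at this
  rw [← cancel_epi (e.hom.app P), ← this, comp_zero]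

/-- The fibre product property on morphisms. Any lift `φ` of `f` misses `g` by a radical morphism,
which comes from `𝒜`; adding it corrects `φ` without changing its reduction. -/
lemma exists_lift {P Q : 𝒜} (f : FA.obj P ⟶ FA.obj Q) (g : G.obj P ⟶ G.obj Q)
    (w : G'.map f ≫ e.hom.app Q = e.hom.app P ≫ FH.map g) :
    ∃ φ : P ⟶ Q, FA.map φ = f ∧ G.map φ = g := by
  have := h.left.full
  obtain ⟨φ, rfl⟩ := FA.map_surjective f
  have hφ : FH.map (g - G.map φ) = 0 := by
    rw [FH.map_sub, sub_eq_zero, ← cancel_epi (e.hom.app P), ← w]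
    exact e.hom.naturality φ
  obtain ⟨j, hj⟩ := h.lift _ hφ
  refine ⟨φ + j, ?_, by rw [G.map_add, hj, add_sub_cancel]⟩
  rw [FA.map_add, h.map_left_eq_zero e j (by rw [hj, hφ]), add_zero]

variable {s : Bdd}
  (γ : hotMap FA s ⋙ hotMap G' s ≅ hotMap G s ⋙ hotMap FH s)
  (hγ : ∀ (K : CochainComplex 𝒜 ℤ) (hK : IsBdd K s), γ.hom.app (hotOf K hK) =
    hotHom ((hK.map FA).map G') ((hK.map G).map FH) (glue e.hom K))
include hγ

lemma toTriples_map_surjective {K L : CochainComplex 𝒜 ℤ} (hK : IsBdd K s) (hL : IsBdd L s)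
    (hK' : ∀ i j, FA.map (K.d i j) = 0) (hL' : ∀ i j, FA.map (L.d i j) = 0) :
    Function.Surjective ((toTriples γ).map : (hotOf K hK ⟶ hotOf L hL) → _) := by
  intro t
  have := h.faithful
  obtain ⟨f, hf⟩ := hotHom_surjective (hK.map FA) (hL.map FA) t.hom.left
  obtain ⟨g, hg⟩ := hotHom_surjective (hK.map G) (hL.map G) t.hom.right
  have w : hotHom ((hK.map FA).map G') ((hL.map G).map FH)
        ((G'.mapHomologicalComplex _).map f ≫ glue e.hom L) =
      hotHom ((hK.map FA).map G') ((hL.map G).map FH)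
        (glue e.hom K ≫ (FH.mapHomologicalComplex _).map g) := by
    rw [hotHom_comp (hM := (hL.map G).map FH) (hL := (hL.map FA).map G'),
      hotHom_comp (hM := (hL.map G).map FH) (hL := (hK.map G).map FH)]
    exact (congrArg₂ (fun a b => (hotMap G' s).map a ≫ b) hf (hγ L hL).symm).trans
      (t.hom.w.trans (congrArg₂ (fun a b => a ≫ (hotMap FH s).map b) (hγ K hK) hg.symm))
  -- Minimality enters here: compatibility up to homotopy becomes strict equality.
  have w' := hotHom_injective _ _ (fun i j => (congrArg G'.map (hK' i j)).trans (G'.map_zero _ _))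
    (fun i j => map_right_eq_zero e _ (hL' i j)) w
  have w'' (i : ℤ) : G'.map (f.f i) ≫ e.hom.app (L.X i) = e.hom.app (K.X i) ≫ FH.map (g.f i) :=
    congrArg (fun x => x.f i) w'
  choose φ hφ₁ hφ₂ using fun i => h.exists_lift e _ _ (w'' i)
  let Φ : K ⟶ L :=
    { f := φ
      -- The lifts commute with the differentials because they do so after the faithful functor `G`.
      comm' := fun i j _ => G.map_injective (by
        rw [G.map_comp, G.map_comp, hφ₂, hφ₂]
        exact g.comm i j) }
  refine ⟨hotHom hK hL Φ, ?_⟩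
  ext : 1
  refine CommaMorphism.ext (Eq.trans ?_ hf) (Eq.trans ?_ hg)
  · exact congrArg (hotHom (hK.map FA) (hL.map FA)) (HomologicalComplex.hom_ext _ _ hφ₁)
  · exact congrArg (hotHom (hK.map G) (hL.map G)) (HomologicalComplex.hom_ext _ _ hφ₂)

theorem full [IsIdempotentComplete 𝒜] : (toTriples γ).Full where
  map_surjective {X Y} t := by
    obtain ⟨K, hK, hK', ⟨a⟩⟩ := h.left.exists_minimal X
    obtain ⟨L, hL, hL', ⟨b⟩⟩ := h.left.exists_minimal Y
    obtain ⟨f, hf⟩ := h.toTriples_map_surjective e γ hγ hK hL hK' hL'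
      ((toTriples γ).map a.inv ≫ t ≫ (toTriples γ).map b.hom)
    let a' := (toTriples γ).mapIso a
    let b' := (toTriples γ).mapIso b
    refine ⟨a.hom ≫ f ≫ b.inv, ?_⟩
    rw [Functor.map_comp, Functor.map_comp, hf]
    change a'.hom ≫ (a'.inv ≫ t ≫ b'.hom) ≫ b'.inv = t
    simp

/-- Each `V.X i` lifts to `P i`, and each component of `θ` to an isomorphism `α i` from `G.obj (P
i)` to `Y.X i`. Transported along `α`, the differential of `Y` is still radical, hence comes from
`𝒜`. -/
theorem exists_toTriples_obj_iso {V : CochainComplex 𝒜' ℤ} {Y : CochainComplex ℋ ℤ}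
    (hV : IsBdd V s) (hY : IsBdd Y s) (hV' : ∀ i j, V.d i j = 0)
    (hY' : ∀ i j, FH.map (Y.d i j) = 0)
    (θ : (hotMap G' s).obj (hotOf V hV) ⟶ (hotMap FH s).obj (hotOf Y hY)) (hθ : IsIso θ) :
    ∃ (X : Hot 𝒜 s) (a : (hotMap FA s).obj X ≅ hotOf V hV) (b : (hotMap G s).obj X ≅ hotOf Y hY),
      (hotMap G' s).map a.hom ≫ θ = γ.hom.app X ≫ (hotMap FH s).map b.hom := by
  have := h.faithful
  have := h.essSurj
  have := h.right.full
  obtain ⟨t, rfl⟩ := hotHom_surjective (hV.map G') (hY.map FH) θ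
  let τ (i : ℤ) : G'.obj (V.X i) ⟶ FH.obj (Y.X i) := t.f i
  have hτ (i : ℤ) : IsIso (τ i) :=
    @isIso_f_of_isIso_hotHom _ _ _ _ _ _ (hV.map G') (hY.map FH)
      (fun i j => (congrArg G'.map (hV' i j)).trans (G'.map_zero _ _)) hY' t hθ i
  let P (i : ℤ) : 𝒜 := FA.objPreimage (V.X i)
  let σ (i : ℤ) : FA.obj (P i) ≅ V.X i := FA.objObjPreimageIso (V.X i)
  have hα (i : ℤ) : ∃ α : G.obj (P i) ⟶ Y.X i,
      FH.map α = e.inv.app (P i) ≫ G'.map (σ i).hom ≫ τ i := FH.map_surjective _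
  choose α hα using hα
  have hα' (i : ℤ) : IsIso (α i) := by
    have : IsIso (FH.map (α i)) := by
      rw [hα]
      infer_instance
    exact h.right.isIso_of_isIso_map _
  let β (i : ℤ) : G.obj (P i) ≅ Y.X i := asIso (α i)
  have hβ (i : ℤ) : (β i).inv ≫ α i = 𝟙 _ := (β i).inv_hom_id
  have hd (i j : ℤ) : FH.map (α i ≫ Y.d i j ≫ (β j).inv) = 0 := by
    rw [FH.map_comp, FH.map_comp, hY', zero_comp, comp_zero]
  choose d hd' using fun i j => h.lift _ (hd i j)
  let X : CochainComplex 𝒜 ℤ :=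
    { X := P
      d := d
      shape := fun i j hij => G.map_injective (by rw [hd', Y.shape _ _ hij]; simp)
      d_comp_d' := fun i j k _ _ => G.map_injective (by
        rw [G.map_comp, hd', hd']
        simp [reassoc_of% hβ]) }
  -- The object `P i` is only a chosen preimage; it vanishes with `V.X i` because `FA` detects zero
  -- objects.
  have hX : IsBdd X s := hV.of_isZero fun i hi => h.left.isZero_of_isZero_map (hi.of_iso (σ i))
  let a : (FA.mapHomologicalComplex _).obj X ≅ V :=
    HomologicalComplex.Hom.isoOfComponents σ fun i j _ => by
      rw [hV', comp_zero]
      exact ((congrArg (· ≫ (σ j).hom) (h.map_left_eq_zero e (d i j)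
        (by rw [hd', hd]))).trans zero_comp).symm
  let b : (G.mapHomologicalComplex _).obj X ≅ Y :=
    HomologicalComplex.Hom.isoOfComponents β fun i j _ => by
      change α i ≫ Y.d i j = G.map (d i j) ≫ α j
      simp [hd', β]
  refine ⟨hotOf X hX, hotIso _ _ a, hotIso _ _ b, ?_⟩
  rw [hγ]
  refine ((hotHom_comp _ _ _ ((G'.mapHomologicalComplex _).map a.hom) t).symm.trans ?_).trans
    (hotHom_comp _ _ _ _ ((FH.mapHomologicalComplex _).map b.hom))
  congr 1
  ext i
  change G'.map (σ i).hom ≫ τ i = e.hom.app (P i) ≫ FH.map (α i)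
  simp [hα]

theorem toTriples_essSurj [IsIdempotentComplete 𝒜'] [IsIdempotentComplete ℋ]
    (hA' : ∀ ⦃P Q : 𝒜'⦄ (d : P ⟶ Q), ∃ h : Q ⟶ P, d ≫ h ≫ d = d) :
    (toTriples γ).EssSurj where
  mem_essImage T := by
    obtain ⟨V, hV, hV', ⟨a⟩⟩ := (IsRadicalQuotient.id hA').exists_minimal T.obj.left
    obtain ⟨Y, hY, hY', ⟨b⟩⟩ := h.right.exists_minimal T.obj.right
    have : IsIso T.obj.hom := T.property
    obtain ⟨X, a', b', w⟩ := h.exists_toTriples_obj_iso e γ hγ hV hY hV' hY'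
      ((hotMap G' s).map a.inv ≫ T.obj.hom ≫ (hotMap FH s).map b.hom) inferInstance
    refine ⟨X, ⟨toTriplesObjIso γ T (a' ≪≫ a.symm) (b' ≪≫ b.symm) ?_⟩⟩
    have := congrArg (· ≫ (hotMap FH s).map b.inv) w
    simp only [Category.assoc, ← Functor.map_comp, Iso.hom_inv_id] at this
    simpa using this

end IsRadicalSquare

end Square

/-! ### Extension of scalars of finitely generated projective modules -/

section

variable {R S : Type u} [Ring R] [Ring S] (f : R →+* S)

/-- A linear map as a morphism of finitely generated projective modules. -/
def proHom {P Q : Pro R} (φ : P.obj →ₗ[R] Q.obj) : P ⟶ Q :=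
  ObjectProperty.homMk (ModuleCat.ofHom φ)

lemma pro_hom_ext {P Q : Pro R} {φ ψ : P ⟶ Q} (h : ∀ x, φ.hom.hom x = ψ.hom.hom x) : φ = ψ := by
  ext x
  exact h x

instance : IsIdempotentComplete (Pro R) where
  idempotents_split X p hp := by
    let g : X.obj →ₗ[R] X.obj := p.hom.hom
    have hg (x : X.obj) : g (g x) = g x := congrArg (fun q : X ⟶ X => q.hom.hom x) hp
    have hg' : g.rangeRestrict ∘ₗ (LinearMap.range g).subtype = LinearMap.id := by
      ext ⟨_, x, rfl⟩
      exact hg x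
    let Y : Pro R := ⟨ModuleCat.of R (LinearMap.range g),
      inferInstanceAs (Module.Finite R (LinearMap.range g)),
      Module.Projective.of_split _ _ hg'⟩
    exact ⟨Y, proHom (P := Y) (LinearMap.range g).subtype, proHom (Q := Y) g.rangeRestrict,
      pro_hom_ext fun x => LinearMap.congr_fun hg' x, rfl⟩

/-- Over a semisimple ring, a section of `P → im d` extends from `im d` to all of `Q`. -/
lemma exists_comp_comp_eq [IsSemisimpleRing R] {P Q : Pro R} (d : P ⟶ Q) :
    ∃ h : Q ⟶ P, d ≫ h ≫ d = d := by
  let g : P.obj →ₗ[R] Q.obj := d.hom.hom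
  obtain ⟨a, ha⟩ := IsSemisimpleModule.lifting_property g.rangeRestrict
    g.surjective_rangeRestrict LinearMap.id
  obtain ⟨b, hb⟩ := IsSemisimpleModule.extension_property (LinearMap.range g).subtype
    (LinearMap.range g).subtype_injective a
  refine ⟨proHom b, pro_hom_ext fun x => ?_⟩
  change g (b (g x)) = g x
  have h₁ : b (g x) = a ⟨g x, x, rfl⟩ := LinearMap.congr_fun hb ⟨g x, x, rfl⟩
  rw [h₁]
  exact congrArg Subtype.val (LinearMap.congr_fun ha ⟨g x, x, rfl⟩)

namespace BaseChange

variable {M N : Type u} [AddCommGroup M] [Module R M] [AddCommGroup N] [Module R N]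

lemma unit_surjective (hf : Function.Surjective f) :
    Function.Surjective (unit f : M → BaseChange f M) := by
  intro x
  induction (span_range_unit f (M := M)).ge (Submodule.mem_top (x := x))
    using Submodule.span_induction with
  | mem x hx => exact hx
  | zero => exact ⟨0, map_zero _⟩
  | add x y _ _ hx hy =>
    obtain ⟨m, rfl⟩ := hx
    obtain ⟨n, rfl⟩ := hy
    exact ⟨m + n, map_add _ _ _⟩
  | smul s x _ hx =>
    obtain ⟨m, rfl⟩ := hx
    obtain ⟨r, rfl⟩ := hf s
    exact ⟨r • m, (unit f).map_smulₛₗ r m⟩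

lemma exists_map_eq (hf : Function.Surjective f) [Module.Projective R M]
    (ψ : BaseChange f M →ₗ[S] BaseChange f N) : ∃ φ : M →ₗ[R] N, map f φ = ψ := by
  let : Module R (BaseChange f N) := Module.compHom _ f
  let p : N →ₗ[R] BaseChange f N :=
    { toFun := unit f, map_add' := map_add _, map_smul' := (unit f).map_smulₛₗ }
  let q : M →ₗ[R] BaseChange f N :=
    { toFun := fun m => ψ (unit f m)
      map_add' := fun x y => by rw [map_add, map_add]
      map_smul' := fun r x => by rw [(unit f).map_smulₛₗ, map_smul]; rfl }
  obtain ⟨φ, hφ⟩ := Module.projective_lifting_property p q (unit_surjective f hf)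
  refine ⟨φ, ext fun m => ?_⟩
  rw [map_tmul]
  exact LinearMap.congr_fun hφ m

lemma mem_smul_top_of_unit_eq_zero (I : Ideal R) [I.IsTwoSided] (m : M)
    (h : unit (Ideal.Quotient.mk I) m = 0) : m ∈ I • (⊤ : Submodule R M) := by
  let q : M →ₛₗ[Ideal.Quotient.mk I] (M ⧸ I • (⊤ : Submodule R M)) :=
    { toFun := (I • (⊤ : Submodule R M)).mkQ
      map_add' := map_add _
      map_smul' := fun _ _ => rfl }
  have h' := congrArg (lift _ q) h
  rw [unit_apply, lift_tmul, one_smul, map_zero] at h'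
  exact (Submodule.Quotient.mk_eq_zero _).1 h'

lemma mem_smul_top_of_map_eq_zero (I : Ideal R) [I.IsTwoSided] (φ : M →ₗ[R] N)
    (h : map (Ideal.Quotient.mk I) φ = 0) (m : M) : φ m ∈ I • (⊤ : Submodule R N) := by
  refine mem_smul_top_of_unit_eq_zero I _ ?_
  rw [unit_apply, ← map_tmul, h, LinearMap.zero_apply]

lemma unit_injective (hf : Function.Injective f) [Module.Projective R M] :
    Function.Injective (unit f : M → BaseChange f M) := by
  rw [injective_iff_map_eq_zero]
  intro m hm
  obtain ⟨σ, hσ⟩ := Module.projective_def.1 ‹Module.Projective R M›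
  have h0 : σ m = 0 := by
    ext x
    -- A projective module embeds in a free one through `σ`. Each coordinate, followed by `f`,
    -- factors through `S ⊗_R M`, so it vanishes on `m`.
    let q : M →ₛₗ[f] S :=
      { toFun := fun m => f (σ m x)
        map_add' := by simp
        map_smul' := by simp }
    have h' := congrArg (lift f q) hm
    rw [unit_apply, lift_tmul, one_smul, map_zero] at h'
    exact hf (h'.trans (map_zero f).symm)
  rw [← hσ m, h0, map_zero]

lemma map_injective (hf : Function.Injective f) [Module.Projective R N] :
    Function.Injective (map f : (M →ₗ[R] N) → _) := fun φ ψ h => by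
  ext m
  apply unit_injective f hf
  simpa using LinearMap.congr_fun h (tmul f 1 m)

/-- If `i ∈ I`, then `i * s = f r` for some `r`, whence `i • (s ⊗ m) = 1 ⊗ r • m`. -/
lemma exists_unit_eq_of_mem_smul_top (I : Ideal S) [I.IsTwoSided] (hI : ∀ i ∈ I, ∃ r, f r = i)
    (x : BaseChange f M) (hx : x ∈ I • (⊤ : Submodule S (BaseChange f M))) :
    ∃ m, unit f m = x := by
  have key (x : BaseChange f M) : ∀ i ∈ I, ∃ m, unit f m = i • x := by
    induction (span_range_unit f (M := M)).ge (Submodule.mem_top (x := x))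
      using Submodule.span_induction with
    | mem x hx =>
      obtain ⟨m, rfl⟩ := hx
      intro i hi
      obtain ⟨r, rfl⟩ := hI i hi
      exact ⟨r • m, (unit f).map_smulₛₗ r m⟩
    | zero => exact fun i hi => ⟨0, by rw [map_zero, smul_zero]⟩
    | add x y _ _ hx hy =>
      intro i hi
      obtain ⟨m, hm⟩ := hx i hi
      obtain ⟨n, hn⟩ := hy i hi
      exact ⟨m + n, by rw [map_add, smul_add, hm, hn]⟩
    | smul s x _ hx =>
      intro i hi
      obtain ⟨m, hm⟩ := hx (i * s) (I.mul_mem_right s hi)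
      exact ⟨m, by rw [hm, mul_smul]⟩
  refine Submodule.smul_induction_on hx (fun i hi x _ => key x i hi) ?_
  rintro _ _ ⟨m, rfl⟩ ⟨n, rfl⟩
  exact ⟨m + n, map_add _ _ _⟩

/-- A map `ψ` that vanishes modulo `I` takes values in `I • (S ⊗_R N)`, which lies in the embedded
copy of `N`; so it restricts to `M → N`. -/
lemma exists_map_eq_of_map_eq_zero (hf : Function.Injective f) [Module.Projective R N]
    (I : Ideal S) [I.IsTwoSided] (hI : ∀ i ∈ I, ∃ r, f r = i)
    (ψ : BaseChange f M →ₗ[S] BaseChange f N) (hψ : map (Ideal.Quotient.mk I) ψ = 0) :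
    ∃ φ : M →ₗ[R] N, map f φ = ψ := by
  choose φ hφ using fun m => exists_unit_eq_of_mem_smul_top f I hI _
    (mem_smul_top_of_map_eq_zero I ψ hψ (unit f m))
  refine ⟨{ toFun := φ, map_add' := fun x y => ?_, map_smul' := fun r x => ?_ }, ext fun m => ?_⟩
  · apply unit_injective f hf
    simp only [map_add, hφ]
  · apply unit_injective f hf
    rw [hφ, (unit f).map_smulₛₗ, map_smul, RingHom.id_apply, (unit f).map_smulₛₗ, hφ]
  · rw [map_tmul]
    exact hφ m

end BaseChange

lemma extendPro_full (hf : Function.Surjective f) : (extendPro f).Full where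
  map_surjective ψ := by
    obtain ⟨φ, hφ⟩ := BaseChange.exists_map_eq f hf ψ.hom.hom
    exact ⟨proHom φ, by ext : 2; exact hφ⟩

lemma extendPro_faithful (hf : Function.Injective f) : (extendPro f).Faithful where
  map_injective h := by
    ext : 2
    exact BaseChange.map_injective f hf (congrArg (fun q => q.hom.hom) h)

lemma pow_mem_smul_top (I : Ideal R) [I.IsTwoSided] {P : Pro R} (φ : End P)
    (h : (extendPro (Ideal.Quotient.mk I)).map φ = 0) (n : ℕ) (x : P.obj) :
    (φ ^ n).hom.hom x ∈ I ^ n • (⊤ : Submodule R P.obj) := by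
  let g : P.obj →ₗ[R] P.obj := φ.hom.hom
  induction n with
  | zero => rw [Submodule.pow_zero, Ideal.one_eq_top, Submodule.top_smul]; trivial
  | succ n ih =>
    rw [pow_succ']
    change g _ ∈ _
    rw [Submodule.pow_succ, Submodule.mul_smul]
    refine Submodule.smul_induction_on (p := fun y => g y ∈ I ^ n • I • (⊤ : Submodule R P.obj))
      ih (fun r hr y _ => ?_) fun y z hy hz => ?_
    · rw [map_smul]
      exact Submodule.smul_mem_smul hr
        (BaseChange.mem_smul_top_of_map_eq_zero I g (congrArg (fun q => q.hom.hom) h) y)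
    · rw [map_add]
      exact add_mem hy hz

variable (R) in
-- The nilpotency exponent of the radical bounds that of every endomorphism in the kernel, for all
-- modules at once.
theorem isRadicalQuotient_extendPro [IsSemiprimaryRing R] :
    IsRadicalQuotient (extendPro (radMk R)) where
  full := extendPro_full _ Ideal.Quotient.mk_surjective
  regular _ _ d := exists_comp_comp_eq d
  nilpotent := by
    obtain ⟨N, hN⟩ := IsSemiprimaryRing.isNilpotent (R := R)
    refine ⟨N, fun P φ h => pro_hom_ext fun x => ?_⟩
    have := pow_mem_smul_top (Ring.jacobson R) φ h N x
    rw [hN, Ideal.zero_eq_bot, Submodule.bot_smul, Submodule.mem_bot] at this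
    exact this

variable (R) in
-- A projective module over `R / rad R` is a retract of the reduction of some `R ^ n`, and
-- idempotents lift.
theorem extendPro_radMk_essSurj [IsSemiprimaryRing R] : (extendPro (radMk R)).EssSurj where
  mem_essImage V := by
    obtain ⟨n, v, hv⟩ := Module.Finite.exists_fin (R := RadQuot R) (M := V.obj)
    let P : Pro R := ⟨ModuleCat.of R (Fin n → R), inferInstanceAs (Module.Finite R (Fin n → R)),
      inferInstanceAs (Module.Projective R (Fin n → R))⟩
    let q : (Fin n → R) →ₛₗ[radMk R] V.obj :=
      { toFun := fun r => ∑ i, radMk R (r i) • v i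
        map_add' := fun x y => by simp [add_smul, Finset.sum_add_distrib]
        map_smul' := fun r x => by simp [mul_smul, Finset.smul_sum] }
    let p : BaseChange (radMk R) (Fin n → R) →ₗ[RadQuot R] V.obj := BaseChange.lift _ q
    have hp : Function.Surjective p := by
      rw [← LinearMap.range_eq_top, eq_top_iff, ← hv, Submodule.span_le]
      rintro _ ⟨i, rfl⟩
      refine ⟨BaseChange.tmul _ 1 (Pi.single i 1), ?_⟩
      rw [BaseChange.lift_tmul, one_smul]
      change ∑ j, radMk R ((Pi.single i 1 : Fin n → R) j) • v j = v i
      rw [Finset.sum_eq_single i (fun j _ hj => by simp [hj]) (by simp)]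
      simp
    obtain ⟨a, ha⟩ := Module.projective_lifting_property p LinearMap.id hp
    exact (isRadicalQuotient_extendPro R).exists_iso_of_retract (P := P) (proHom a) (proHom p)
      (pro_hom_ext fun x => LinearMap.congr_fun ha x)

end

/-! ### The functor `E` -/

section Main

variable {k : Type v} [Field k] {H : Type u} [Ring H] [Algebra k H] {A : Subalgebra k H}

lemma barMap_injective (hrad : SameRadical A) : Function.Injective (barMap hrad) := by
  rw [injective_iff_map_eq_zero]
  intro x hx
  obtain ⟨a, rfl⟩ := Ideal.Quotient.mk_surjective x
  have ha : (a : H) ∈ (Ring.jacobson H : Set H) := Ideal.Quotient.eq_zero_iff_mem.1 hx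
  rw [← hrad] at ha
  obtain ⟨b, hb, hab⟩ := ha
  obtain rfl : b = a := Subtype.ext hab
  exact Ideal.Quotient.eq_zero_iff_mem.2 hb

theorem isRadicalSquare [IsSemiprimaryRing A] [IsSemiprimaryRing H] (hrad : SameRadical A) :
    IsRadicalSquare (extendPro (radMk A)) (extendPro (radMk H)) (extendPro (incl A))
      (extendPro (barMap hrad)) where
  left := isRadicalQuotient_extendPro A
  right := isRadicalQuotient_extendPro H
  essSurj := extendPro_radMk_essSurj A
  faithful := extendPro_faithful _ Subtype.val_injective
  faithful' := extendPro_faithful _ (barMap_injective hrad)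
  lift P Q ψ hψ := by
    obtain ⟨φ, hφ⟩ := BaseChange.exists_map_eq_of_map_eq_zero (incl A) Subtype.val_injective
      (Ring.jacobson H)
      (fun i hi => by
        obtain ⟨a, -, ha⟩ := hrad.ge hi
        exact ⟨a, ha⟩)
      ψ.hom.hom (congrArg (fun q => q.hom.hom) hψ)
    exact ⟨proHom φ, by ext : 2; exact hφ⟩

/-- The canonical isomorphism `H̄ ⊗_Ā (Ā ⊗_A -) ≅ H̄ ⊗_H (H ⊗_A -)` on `A-pro`. -/
def gluingPro (hrad : SameRadical A) : extendPro (radMk A) ⋙ extendPro (barMap hrad) ≅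
    extendPro (incl A) ⋙ extendPro (radMk H) :=
  extendProComp (radMk A) (barMap hrad) _ (barMap_comp hrad) ≪≫
    (extendProComp (incl A) (radMk H) _ rfl).symm

lemma gluing_hom_app (hrad : SameRadical A) {s : Bdd} (K : CochainComplex (Pro A) ℤ)
    (hK : IsBdd K s) : (gluing hrad s).hom.app (hotOf K hK) =
      hotHom ((hK.map _).map _) ((hK.map _).map _) (glue (gluingPro hrad).hom K) := by
  ext : 1
  refine Eq.trans ?_ ((HomotopyCategory.quotient _ _).map_comp
    ((Functor.mapHomologicalComplexCompIso (extendProComp (radMk A) (barMap hrad) _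
      (barMap_comp hrad)) _).hom.app K)
    ((Functor.mapHomologicalComplexCompIso (extendProComp (incl A) (radMk H) _ rfl)
      _).inv.app K)).symm
  rfl

lemma E_eq_toTriples (hrad : SameRadical A) (s : Bdd) : E hrad s = toTriples (gluing hrad s) := rfl

end Main

end TriplesCat

end

theorem theoremT (k : Type v) [Field k] [IsAlgClosed k] (H : Type u) [Ring H] [Algebra k H]
    [FiniteDimensional k H] (A : Subalgebra k H) (hrad : TriplesCat.SameRadical A)
    (s : TriplesCat.Bdd) :
    (TriplesCat.E hrad s).Full ∧
    (TriplesCat.E hrad s).EssSurj ∧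
    (∀ X₁ X₂ : TriplesCat.Hot (TriplesCat.Pro A) s,
      Nonempty ((TriplesCat.E hrad s).obj X₁ ≅ (TriplesCat.E hrad s).obj X₂) ↔
        Nonempty (X₁ ≅ X₂)) ∧
    (∀ X : TriplesCat.Hot (TriplesCat.Pro A) s,
      Indecomposable ((TriplesCat.E hrad s).obj X) ↔ Indecomposable X) := by
  -- Artinian rings are semiprimary: the radical is nilpotent with semisimple quotient.
  have : IsArtinianRing H := IsArtinianRing.of_finite k H
  have : IsArtinianRing A := IsArtinianRing.of_finite k A
  have h := TriplesCat.isRadicalSquare hrad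
  have hγ := TriplesCat.gluing_hom_app hrad (s := s)
  rw [TriplesCat.E_eq_toTriples]
  have h₁ := h.full (TriplesCat.gluingPro hrad) _ hγ
  have h₂ := h.toTriples_essSurj (TriplesCat.gluingPro hrad) _ hγ h.left.regular
  -- The component `X ↦ Ā ⊗_A X` of `E` already reflects isomorphisms, so `E` does.
  have := h.left.reflectsIsomorphisms_hotMap (s := s)
  exact ⟨h₁, h₂, TriplesCat.nonempty_iso_iff _, TriplesCat.indecomposable_map_iff _⟩
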